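/- Let $\Gamma$ be an arbitrary set, let $\mathbb{R}^\Gamma$ carry the product topology, and let $\Sigma(\mathbb{R}^\Gamma)=\{x\in\mathbb{R}^\Gamma : \{\gamma\in\Gamma : x(\gamma)\neq 0\}\text{ is countable}\}$ (finite sets, including the empty set, count as countable). A space $X$ is called scattered if every nonempty subset $T\subseteq X$ has a point that is isolated in $T$ with respect to the subspace topology. If $X\subseteq\Sigma(\mathbb{R}^\Gamma)$, with the subspace topology, is Lindelöf (every open cover has a countable subcover) and scattered, then $X$ is $\sigma$-compact, i.e. a union of countably many compact subsets. -/

import Mathlib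

/-- A subset `S` of a topological space is scattered (as a subspace) if every nonempty subset `T`
of `S` has a relatively isolated point, i.e. a point `x ∈ T` with `{x}` relatively open in `T`. -/
def IsScattered {Z : Type*} [TopologicalSpace Z] (S : Set Z) : Prop :=
  ∀ T : Set Z, T ⊆ S → T.Nonempty → ∃ x ∈ T, ∃ U : Set Z, IsOpen U ∧ U ∩ T = {x}

/-- The `Σ`-product of the family `Y` with base point `a`: the points of the full product that
differ from `a` on at most countably many coordinates. -/
def sigmaProduct {Γ : Type*} (Y : Γ → Type*) (a : ∀ γ, Y γ) : Set (∀ γ, Y γ) :=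
  {y | {γ : Γ | y γ ≠ a γ}.Countable}

/-- The `Σ`-product of real lines `Σ(ℝ^Γ) = Σ(ℝ^Γ, 0)`: points of `ℝ^Γ` with countable support. -/
def sigmaReal (Γ : Type*) : Set (Γ → ℝ) :=
  sigmaProduct (fun _ : Γ => ℝ) (fun _ => 0)

open Set Filter Topology Cardinal Function

section Traces

variable {Γ : Type*}

/-! A trace makes restriction to a closed coordinate set `A` map `X` into `X`, with countable image
if `A` is countable. Scatteredness and Lindelöfness provide one (`IsLindelof.traceable`). By
induction on `#A`, the points of `X` supported in a closed `A` form a σ-compact set: an uncountable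
`A` is an increasing union of smaller closed sets along a well-order. Each point meets only finitely
many levels of this chain, because its restriction to a countable increasing union is already
supported in one member. `isSigmaCompact_of_levels` then assembles the pieces. -/

/-- A set of coordinates is closed for `C` if it contains the supports of all points which `C`
assigns to its finite subsets. -/
def SupportClosed (C : Finset Γ → Set (Γ → ℝ)) (A : Set Γ) : Prop :=
  ∀ s : Finset Γ, ↑s ⊆ A → ∀ y ∈ C s, support y ⊆ A

/-- `C` assigns to every finite set of coordinates countably many points of `X`, so that the
restriction of a point of `Y` to a closed set `A` of coordinates is among the points assigned to
the finite subsets of `A`. -/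
structure IsTrace (X Y : Set (Γ → ℝ)) (C : Finset Γ → Set (Γ → ℝ)) : Prop where
  countable : ∀ s, (C s).Countable
  subset : ∀ s, C s ⊆ X
  exists_mem : ∀ A, SupportClosed C A → ∀ x ∈ Y, ∃ s : Finset Γ, ↑s ⊆ A ∧ A.indicator x ∈ C s

/-- `Y` has a trace with values in `X`. -/
def Traceable (X Y : Set (Γ → ℝ)) : Prop := ∃ C, IsTrace X Y C

theorem Traceable.mono {X Y Y' : Set (Γ → ℝ)} (h : Traceable X Y) (hY : Y' ⊆ Y) :
    Traceable X Y' := by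
  obtain ⟨C, h1, h2, h3⟩ := h
  exact ⟨C, h1, h2, fun A hA x hx => h3 A hA x (hY hx)⟩

theorem traceable_empty (X : Set (Γ → ℝ)) : Traceable X ∅ :=
  ⟨fun _ => ∅, fun _ => countable_empty, fun _ => empty_subset _, fun _ _ _ hx => hx.elim⟩

theorem Traceable.iUnion {κ : Type*} [Countable κ] {X : Set (Γ → ℝ)} {Y : κ → Set (Γ → ℝ)}
    (h : ∀ k, Traceable X (Y k)) : Traceable X (⋃ k, Y k) := by
  choose C hC using h
  refine ⟨fun s => ⋃ k, C k s, fun s => countable_iUnion fun k => (hC k).countable s,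
    fun s => iUnion_subset fun k => (hC k).subset s, fun A hA x hx => ?_⟩
  obtain ⟨k, hk⟩ := mem_iUnion.1 hx
  obtain ⟨s, hs, hxs⟩ := (hC k).exists_mem A
    (fun s hs y hy => hA s hs y (mem_iUnion.2 ⟨k, hy⟩)) x hk
  exact ⟨s, hs, mem_iUnion.2 ⟨k, hxs⟩⟩

/-- Traces of the parts of `Y` that one coordinate separates from `p` give a trace of `Y`. -/
theorem traceable_of_separated {X Y : Set (Γ → ℝ)} {p : Γ → ℝ} (hp : p ∈ X)
    (h : ∀ (γ : Γ) (m : ℕ), Traceable X (Y ∩ {y | 1 / ((m : ℝ) + 1) ≤ |y γ - p γ|})) :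
    Traceable X Y := by
  classical
  choose C hC using h
  -- Taking all subsets `s'` of `s` allows the separating coordinate to be adjoined to a finite set
  -- without losing assigned points.
  refine ⟨fun s => {p} ∪ ⋃ γ ∈ s, ⋃ m, ⋃ s' ∈ s.powerset, C γ m s', fun s => ?_, fun s => ?_,
    fun A hA x hx => ?_⟩
  · refine (countable_singleton p).union ?_
    refine s.countable_toSet.biUnion fun γ _ => countable_iUnion fun m => ?_
    exact s.powerset.countable_toSet.biUnion fun s' _ => (hC γ m).countable s'
  · refine union_subset (singleton_subset_iff.2 hp) ?_
    exact iUnion₂_subset fun γ _ => iUnion_subset fun m => iUnion₂_subset fun s' _ =>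
      (hC γ m).subset s'
  · have hpA : support p ⊆ A := hA ∅ (by simp) p (by simp)
    by_cases hxp : A.indicator x = p
    · exact ⟨∅, by simp, by simp [hxp]⟩
    obtain ⟨γ, hγ⟩ := Function.ne_iff.1 hxp
    have hγA : γ ∈ A := by
      by_contra hn
      rw [indicator_of_notMem hn] at hγ
      exact hn (hpA (mem_support.2 hγ.symm))
    rw [indicator_of_mem hγA] at hγ
    obtain ⟨m, hm⟩ := exists_nat_one_div_lt (abs_pos.2 (sub_ne_zero.2 hγ))
    have key : ∀ s' : Finset Γ, C γ m s' ⊆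
        {p} ∪ ⋃ γ' ∈ insert γ s', ⋃ m, ⋃ t ∈ (insert γ s').powerset, C γ' m t := by
      intro s' y hy
      refine Or.inr ?_
      simp only [mem_iUnion]
      exact ⟨γ, Finset.mem_insert_self _ _, m, s',
        Finset.mem_powerset.2 (Finset.subset_insert _ _), hy⟩
    have hins : ∀ s' : Finset Γ, ↑s' ⊆ A → (↑(insert γ s') : Set Γ) ⊆ A := fun s' hs' => by
      rw [Finset.coe_insert]
      exact insert_subset hγA hs'
    obtain ⟨s, hs, hxs⟩ := (hC γ m).exists_mem A
      (fun s' hs' y hy => hA (insert γ s') (hins s' hs') y (key s' hy)) x ⟨hx, hm.le⟩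
    exact ⟨insert γ s, hins s hs, key s hxs⟩

theorem IsLindelof.traceable_of_nhds {X Y : Set (Γ → ℝ)} (hY : IsLindelof Y)
    (h : ∀ x ∈ Y, ∃ U ∈ 𝓝 x, Traceable X (X ∩ U)) (hYX : Y ⊆ X) : Traceable X Y := by
  refine hY.induction_on (p := Traceable X) (fun s t hst ht => ht.mono hst)
    (fun S hS hp => ?_) fun x hx => ?_
  · have := hS.to_subtype
    rw [sUnion_eq_iUnion]
    exact Traceable.iUnion fun k => hp k k.2
  · obtain ⟨U, hU, hT⟩ := h x hx
    exact ⟨Y ∩ U, inter_mem self_mem_nhdsWithin (mem_nhdsWithin_of_mem_nhds hU),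
      hT.mono (inter_subset_inter_left _ hYX)⟩

/-- If some points had no traceable neighbourhood, let `p` be isolated among them. In a small closed
neighbourhood of `p`, the pieces separated from `p` by one coordinate are Lindelöf and consist of
good points, so they are traceable, which makes `p` good. -/
theorem IsLindelof.traceable {X : Set (Γ → ℝ)} (hL : IsLindelof X) (hS : IsScattered X) :
    Traceable X X := by
  refine hL.traceable_of_nhds (fun x hx => ?_) Subset.rfl
  by_contra hbad
  obtain ⟨p, hpT, U, hU, hUT⟩ := hS {x ∈ X | ¬ ∃ U ∈ 𝓝 x, Traceable X (X ∩ U)}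
    (fun _ h => h.1) ⟨x, hx, hbad⟩
  have hpU : p ∈ U := (hUT.symm ▸ mem_singleton p : p ∈ U ∩ _).1
  obtain ⟨V, hV, hVc, hVU⟩ := exists_mem_nhds_isClosed_subset (hU.mem_nhds hpU)
  refine hpT.2 ⟨V, hV, traceable_of_separated hpT.1 fun γ m => ?_⟩
  have hc : IsClosed {y : Γ → ℝ | 1 / ((m : ℝ) + 1) ≤ |y γ - p γ|} :=
    isClosed_le continuous_const (by fun_prop)
  refine ((hL.inter_right hVc).inter_right hc).traceable_of_nhds (fun y hy => ?_)
    (fun y hy => hy.1.1)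
  by_contra hyb
  have : y ∈ U ∩ {x ∈ X | ¬ ∃ U ∈ 𝓝 x, Traceable X (X ∩ U)} := ⟨hVU hy.1.2, hy.1.1, hyb⟩
  rw [hUT, mem_singleton_iff] at this
  have h1 := hy.2
  rw [this, mem_ofPred_eq, sub_self, abs_zero] at h1
  exact absurd h1 (not_le.2 Nat.one_div_pos_of_nat)

/-! ### Closing coordinate sets under supports -/

theorem exists_subset_of_subset_iUnion_monotone {B : ℕ → Set Γ} (hB : Monotone B)
    {s : Finset Γ} (hs : ↑s ⊆ ⋃ n, B n) : ∃ n, ↑s ⊆ B n := by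
  have : ∀ γ, ∃ n, γ ∈ s → γ ∈ B n := fun γ => by
    by_cases h : γ ∈ s
    · obtain ⟨n, hn⟩ := mem_iUnion.1 (hs h)
      exact ⟨n, fun _ => hn⟩
    · exact ⟨0, fun h' => absurd h' h⟩
  choose f hf using this
  exact ⟨s.sup f, fun γ hγ => hB (Finset.le_sup hγ) (hf γ hγ)⟩

theorem SupportClosed.iUnion {C : Finset Γ → Set (Γ → ℝ)} {B : ℕ → Set Γ} (hB : Monotone B)
    (h : ∀ n, SupportClosed C (B n)) : SupportClosed C (⋃ n, B n) := by
  intro s hs y hy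
  obtain ⟨n, hn⟩ := exists_subset_of_subset_iUnion_monotone hB hs
  exact (h n s hn y hy).trans (subset_iUnion B n)

/-- One step of closing a set of coordinates under the supports of assigned points. -/
def supportStep (C : Finset Γ → Set (Γ → ℝ)) (S : Set Γ) : Set Γ :=
  S ∪ ⋃ s : Finset S, ⋃ y ∈ C (s.map (Embedding.subtype _)), support y

/-- The least closed set of coordinates containing `S`. -/
def supportHull (C : Finset Γ → Set (Γ → ℝ)) (S : Set Γ) : Set Γ :=
  ⋃ n : ℕ, (supportStep C)^[n] S

section Hull

variable {C : Finset Γ → Set (Γ → ℝ)}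

theorem support_subset_supportStep {S : Set Γ} {s : Finset Γ} (hs : ↑s ⊆ S) {y : Γ → ℝ}
    (hy : y ∈ C s) : support y ⊆ supportStep C S := by
  classical
  intro γ hγ
  refine Or.inr (mem_iUnion.2 ⟨s.subtype (· ∈ S), mem_iUnion₂.2 ⟨y, ?_, hγ⟩⟩)
  rwa [Finset.subtype_map_of_mem (fun x hx => hs hx)]

theorem supportStep_subset {S A : Set Γ} (hA : SupportClosed C A) (h : S ⊆ A) :
    supportStep C S ⊆ A := by
  refine union_subset h (iUnion_subset fun s => iUnion₂_subset fun y hy => hA _ ?_ y hy)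
  intro γ hγ
  obtain ⟨a, -, rfl⟩ := Finset.mem_map.1 (Finset.mem_coe.1 hγ)
  exact h a.2

theorem monotone_supportStep_iterate (S : Set Γ) :
    Monotone fun n => (supportStep C)^[n] S :=
  monotone_nat_of_le_succ fun n => by
    rw [iterate_succ_apply']
    exact subset_union_left

theorem supportClosed_supportHull (S : Set Γ) : SupportClosed C (supportHull C S) := by
  intro s hs y hy
  obtain ⟨n, hn⟩ := exists_subset_of_subset_iUnion_monotone (monotone_supportStep_iterate S) hs
  have := support_subset_supportStep hn hy
  rw [← iterate_succ_apply' (supportStep C)] at this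
  exact this.trans (subset_iUnion (fun n => (supportStep C)^[n] S) _)

theorem subset_supportHull (S : Set Γ) : S ⊆ supportHull C S :=
  subset_iUnion (fun n => (supportStep C)^[n] S) 0

theorem supportHull_subset {S A : Set Γ} (hA : SupportClosed C A) (h : S ⊆ A) :
    supportHull C S ⊆ A := by
  refine iUnion_subset fun n => ?_
  induction n with
  | zero => exact h
  | succ n ih =>
    rw [iterate_succ_apply']
    exact supportStep_subset hA ih

theorem supportHull_mono {S T : Set Γ} (h : S ⊆ T) : supportHull C S ⊆ supportHull C T :=
  supportHull_subset (supportClosed_supportHull T) (h.trans (subset_supportHull T))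

theorem mk_supportStep_le (hC : ∀ s, (C s).Countable) (hsupp : ∀ s, ∀ y ∈ C s, (support y).Countable)
    {S : Set Γ} {c : Cardinal} (hc : ℵ₀ ≤ c) (hS : #S ≤ c) : #(supportStep C S) ≤ c := by
  refine (mk_union_le _ _).trans (add_le_of_le hc hS ?_)
  refine (mk_iUnion_le _).trans (mul_le_of_le hc ?_ ?_)
  · refine (mk_le_of_injective (f := Finset.toList) fun s t h => ?_).trans ?_
    · classical rw [← s.toList_toFinset, ← t.toList_toFinset, h]
    exact (mk_list_le_max _).trans (max_le hc hS)
  · refine ciSup_le' fun s => ?_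
    have : (⋃ y ∈ C (s.map (Embedding.subtype _)), support y).Countable :=
      (hC _).biUnion fun y hy => hsupp _ y hy
    exact this.le_aleph0.trans hc

theorem mk_supportHull_le (hC : ∀ s, (C s).Countable)
    (hsupp : ∀ s, ∀ y ∈ C s, (support y).Countable)
    {S : Set Γ} {c : Cardinal} (hc : ℵ₀ ≤ c) (hS : #S ≤ c) : #(supportHull C S) ≤ c := by
  have h : ∀ n, #((supportStep C)^[n] S : Set Γ) ≤ c := fun n => by
    induction n with
    | zero => exact hS
    | succ n ih =>
      rw [iterate_succ_apply']
      exact mk_supportStep_le hC hsupp hc ih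
  have h1 := mk_iUnion_le_lift (fun n => (supportStep C)^[n] S)
  rw [lift_uzero, mk_nat, lift_aleph0] at h1
  exact h1.trans (mul_le_of_le hc hc (ciSup_le' fun n => by simpa using h n))

end Hull

/-! ### Compactness and σ-compactness by levels -/

/-- The closure of `F` works: a coordinate unbounded on `F` would give an ultrafilter on `F` without
a limit. -/
theorem exists_isCompact_of_ultrafilter {F Z : Set (Γ → ℝ)}
    (h : ∀ U : Ultrafilter (Γ → ℝ), F ∈ U → ∃ z ∈ Z, ↑U ≤ 𝓝 z) :
    ∃ K, IsCompact K ∧ F ⊆ K ∧ K ⊆ Z := by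
  have hb : ∀ γ, ∃ L : Set ℝ, IsCompact L ∧ ∀ x ∈ F, x γ ∈ L := by
    intro γ
    by_contra hn
    push Not at hn
    have hne : NeBot (comap (fun x : Γ → ℝ => x γ) (cocompact ℝ) ⊓ 𝓟 F) := by
      rw [inf_principal_neBot_iff]
      rintro W ⟨V, hV, hVW⟩
      obtain ⟨L, hL, hLV⟩ := mem_cocompact.1 hV
      obtain ⟨x, hx, hxL⟩ := hn L hL
      exact ⟨x, hVW (hLV hxL), hx⟩
    have hle := Ultrafilter.of_le (comap (fun x : Γ → ℝ => x γ) (cocompact ℝ) ⊓ 𝓟 F)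
    obtain ⟨z, -, hz⟩ := h (Ultrafilter.of _) (le_principal_iff.1 (hle.trans inf_le_right))
    have h1 : Tendsto (fun x : Γ → ℝ => x γ)
        (Ultrafilter.of (comap (fun x : Γ → ℝ => x γ) (cocompact ℝ) ⊓ 𝓟 F)) (𝓝 (z γ)) :=
      ((continuous_apply γ).tendsto z).mono_left hz
    have h2 : Tendsto (fun x : Γ → ℝ => x γ)
        (Ultrafilter.of (comap (fun x : Γ → ℝ => x γ) (cocompact ℝ) ⊓ 𝓟 F)) (cocompact ℝ) :=
      tendsto_comap.mono_left (hle.trans inf_le_left)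
    exact (disjoint_nhds_cocompact (z γ)).le_bot.not_gt
      (bot_lt_iff_ne_bot.2 (NeBot.mono (map_neBot) (le_inf h1 h2)).ne)
  choose L hL hFL using hb
  have hLc : IsCompact (univ.pi L) := isCompact_univ_pi hL
  refine ⟨closure F, hLc.closure_of_subset fun x hx γ _ => hFL γ x hx, subset_closure, ?_⟩
  intro x hx
  obtain ⟨U, hFU, hUx⟩ := mem_closure_iff_ultrafilter.1 hx
  obtain ⟨z, hz, hUz⟩ := h U hFU
  rwa [tendsto_nhds_unique hUx hUz]

/-- A set of functions that are supported on finitely many levels of `ρ` is σ-compact if it is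
stable under cutting off at each level and its parts below each level are σ-compact. -/
theorem isSigmaCompact_of_levels {ι : Type*} [LinearOrder ι] [Nonempty ι] (ρ : Γ → ι)
    {Z : Set (Γ → ℝ)} (hfin : ∀ x ∈ Z, (ρ '' support x).Finite)
    (hcut : ∀ x ∈ Z, ∀ i, {γ | ρ γ ≤ i}.indicator x ∈ Z)
    (hσ : ∀ i, IsSigmaCompact (Z ∩ {x | support x ⊆ {γ | ρ γ ≤ i}})) : IsSigmaCompact Z := by
  classical
  let i₀ : ι := Classical.arbitrary ι
  choose K hK hKZ using hσ
  let F : (Σ n : ℕ, (Fin n → ℕ)) → Set (Γ → ℝ) := fun c =>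
    {x | ∃ α : Fin c.1 → ι, (∃ l, α l = i₀) ∧ (∀ γ, x γ ≠ 0 → ∃ l, α l = ρ γ) ∧
      ∀ l, {γ | ρ γ ≤ α l}.indicator x ∈ K (α l) (c.2 l)}
  have hF : ∀ c, ∃ K', IsCompact K' ∧ F c ⊆ K' ∧ K' ⊆ Z := by
    rintro ⟨n, k⟩
    refine exists_isCompact_of_ultrafilter fun U hU => ?_
    have hch : ∀ x, ∃ α : Fin n → ι, x ∈ F ⟨n, k⟩ →
        (∃ l, α l = i₀) ∧ (∀ γ, x γ ≠ 0 → ∃ l, α l = ρ γ) ∧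
        ∀ l, {γ | ρ γ ≤ α l}.indicator x ∈ K (α l) (k l) := fun x => by
      by_cases hx : x ∈ F ⟨n, k⟩
      · obtain ⟨α, hα⟩ := hx
        exact ⟨α, fun _ => hα⟩
      · exact ⟨fun _ => i₀, fun h => absurd h hx⟩
    choose α hα using hch
    have hα1 : ∀ᶠ x in U, ∃ l, α x l = i₀ := by
      filter_upwards [hU] with x hx using (hα x hx).1
    -- Forcing `i₀` among the levels ensures that some index is constant along `U`.
    obtain ⟨l₀, hl₀⟩ := Ultrafilter.eventually_exists_iff.1 hα1
    have hc : ∀ l, ∃ a, (∃ b, ∀ᶠ x in U, α x l = b) → ∀ᶠ x in U, α x l = a := fun l => by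
      by_cases h : ∃ b, ∀ᶠ x in U, α x l = b
      · exact ⟨h.choose, fun _ => h.choose_spec⟩
      · exact ⟨i₀, fun h' => absurd h' h⟩
    choose a ha using hc
    -- Cut at the largest level that is constant along `U`; a coordinate above it must vanish
    -- `U`-almost everywhere, else its level would also be constant.
    obtain ⟨m, hm, hmax⟩ := Finset.exists_max_image
      (Finset.univ.filter fun l => ∃ b, ∀ᶠ x in U, α x l = b) a
      ⟨l₀, by simpa using ⟨i₀, hl₀⟩⟩
    have hm' := ha m (Finset.mem_filter.1 hm).2
    have hev : ∀ᶠ x in U, {γ | ρ γ ≤ a m}.indicator x ∈ K (a m) (k m) := by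
      filter_upwards [hU, hm'] with x hx hxm
      exact hxm ▸ (hα x hx).2.2 m
    obtain ⟨z, hz, hUz⟩ := (hK (a m) (k m)).ultrafilter_le_nhds
      (U.map fun x => {γ | ρ γ ≤ a m}.indicator x) (le_principal_iff.2 hev)
    have hzZ : z ∈ Z ∩ {x | support x ⊆ {γ | ρ γ ≤ a m}} :=
      hKZ (a m) ▸ mem_iUnion.2 ⟨k m, hz⟩
    refine ⟨z, hzZ.1, ?_⟩
    have hUz' : Tendsto (fun x : Γ → ℝ => {γ | ρ γ ≤ a m}.indicator x) U (𝓝 z) := hUz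
    rw [tendsto_pi_nhds] at hUz'
    change Tendsto id (U : Filter (Γ → ℝ)) (𝓝 z)
    rw [tendsto_pi_nhds]
    intro γ
    refine (hUz' γ).congr' ?_
    by_cases hγ : ρ γ ≤ a m
    · exact Eventually.of_forall fun x => indicator_of_mem (s := {γ | ρ γ ≤ a m}) hγ x
    have hz0 : ∀ᶠ x : Γ → ℝ in U, x γ = 0 := by
      by_contra hn
      have hn' : ∀ᶠ x : Γ → ℝ in U, x γ ≠ 0 := Ultrafilter.eventually_not.2 hn
      have : ∀ᶠ x in U, ∃ l, α x l = ρ γ := by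
        filter_upwards [hU, hn'] with x hx hxγ using (hα x hx).2.1 γ hxγ
      obtain ⟨l, hl⟩ := Ultrafilter.eventually_exists_iff.1 this
      have h1 := hmax l (by simpa using ⟨ρ γ, hl⟩)
      obtain ⟨x, hx1, hx2⟩ := (hl.and (ha l ⟨ρ γ, hl⟩)).exists
      exact hγ (hx1 ▸ hx2 ▸ h1)
    filter_upwards [hz0] with x hx
    exact (indicator_of_notMem (s := {γ | ρ γ ≤ a m}) hγ x).trans hx.symm
  choose K' hK' hFK hKZ' using hF
  have hZ : Z = ⋃ c, K' c := by
    refine Subset.antisymm (fun x hx => ?_) (iUnion_subset hKZ')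
    let R : Finset ι := insert i₀ (hfin x hx).toFinset
    let α : Fin R.card → ι := fun l => (R.equivFin.symm l : ι)
    have hαs : ∀ r ∈ R, ∃ l, α l = r := fun r hr => ⟨R.equivFin ⟨r, hr⟩, by simp [α]⟩
    have hk : ∀ l, ∃ j, {γ | ρ γ ≤ α l}.indicator x ∈ K (α l) j := fun l => by
      have : {γ | ρ γ ≤ α l}.indicator x ∈ Z ∩ {x | support x ⊆ {γ | ρ γ ≤ α l}} :=
        ⟨hcut x hx _, support_indicator_subset⟩
      rw [← hKZ] at this
      exact mem_iUnion.1 this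
    choose k hk using hk
    refine mem_iUnion.2 ⟨⟨R.card, k⟩, hFK _ ⟨α, hαs _ (Finset.mem_insert_self _ _),
      fun γ hγ => hαs _ (Finset.mem_insert_of_mem ?_), hk⟩⟩
    exact (hfin x hx).mem_toFinset.2 ⟨γ, hγ, rfl⟩
  rw [hZ]
  exact isSigmaCompact_iUnion_of_isCompact _ hK'

theorem Set.Countable.isSigmaCompact {Z : Type*} [TopologicalSpace Z] {s : Set Z}
    (hs : s.Countable) : IsSigmaCompact s := by
  rw [← biUnion_of_singleton s]
  exact isSigmaCompact_biUnion hs fun _ _ => isCompact_singleton.isSigmaCompact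

theorem Set.Infinite.exists_strictMono_nat {ι : Type*} [LinearOrder ι] [WellFoundedLT ι]
    {R : Set ι} (hR : R.Infinite) : ∃ f : ℕ → ι, StrictMono f ∧ ∀ n, f n ∈ R := by
  let e := hR.natEmbedding
  obtain ⟨g, hg | hg⟩ := exists_increasing_or_nonincreasing_subseq (· < ·) fun n => (e n : ι)
  · exact ⟨fun n => e (g n), fun m n h => hg m n h, fun n => (e (g n)).2⟩
  · exfalso
    have hanti : StrictAnti fun n => (e (g n) : ι) := fun m n h =>
      lt_of_le_of_ne (not_lt.1 (hg m n h)) fun h' =>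
        h.ne' (g.injective (e.injective (Subtype.ext h')))
    exact (WellFounded.not_rel_apply_succ (r := (· < ·)) fun n => (e (g n) : ι)).elim
      fun n hn => hn (hanti n.lt_succ_self)

/-! ### Induction on the number of coordinates -/

theorem IsTrace.isSigmaCompact_of_supportClosed {X : Set (Γ → ℝ)} (hX : X ⊆ sigmaReal Γ)
    {C : Finset Γ → Set (Γ → ℝ)} (hC : IsTrace X X C) (A : Set Γ) (hA : SupportClosed C A) :
    IsSigmaCompact (X ∩ {x | support x ⊆ A}) := by
  classical
  induction hcard : #A using WellFoundedLT.induction generalizing A with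
  | ind c ih =>
  subst hcard
  by_cases hcount : A.Countable
  · have hs : {s : Finset Γ | ↑s ⊆ A}.Countable := by
      refine ((Set.countable_ofPred_finite_subset hcount).preimage Finset.coe_injective).mono ?_
      intro s hs
      exact And.intro s.finite_toSet hs
    refine Set.Countable.isSigmaCompact ((hs.biUnion fun s _ => hC.countable s).mono ?_)
    rintro x ⟨hx, hxA⟩
    obtain ⟨s, hs, hxs⟩ := hC.exists_mem A hA x hx
    rw [indicator_eq_self.2 hxA] at hxs
    exact mem_biUnion hs hxs
  have hlt : ℵ₀ < #A := by rwa [← not_le, le_aleph0_iff_set_countable]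
  -- A well-order of initial type keeps proper initial segments, hence their hulls, smaller than
  -- `A`.
  obtain ⟨_, _, hord⟩ := exists_ord_eq_type_lt A
  have hsupp : ∀ s, ∀ y ∈ C s, (support y).Countable := fun s y hy => hX (hC.subset s hy)
  have hne : Nonempty A := by
    rw [← mk_ne_zero_iff]
    exact (aleph0_pos.trans hlt).ne'
  let B : A → Set Γ := fun i => supportHull C (Subtype.val '' Iic i)
  have hBc : ∀ i, SupportClosed C (B i) := fun i => supportClosed_supportHull _
  have hBA : ∀ i, B i ⊆ A := fun i => supportHull_subset hA (by rintro _ ⟨j, -, rfl⟩; exact j.2)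
  have hBm : Monotone B := fun i j hij => supportHull_mono (image_mono (Iic_subset_Iic.2 hij))
  have hBcard : ∀ i, #(B i) < #A := fun i => by
    refine (mk_supportHull_le hC.countable hsupp (le_max_left ℵ₀ _)
      (mk_image_le.trans (le_max_right ℵ₀ _))).trans_lt (max_lt hlt ?_)
    exact mk_Iic_lt i hord hlt.le
  -- The level of `γ` is the first `i` with `γ ∈ B i`.
  have hρ : ∀ γ, ∃ i, γ ∈ A → ∀ j, γ ∈ B j ↔ i ≤ j := fun γ => by
    by_cases hγ : γ ∈ A
    · have hn : {i | γ ∈ B i}.Nonempty :=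
        ⟨⟨γ, hγ⟩, subset_supportHull _ ⟨⟨γ, hγ⟩, mem_Iic.2 le_rfl, rfl⟩⟩
      refine ⟨wellFounded_lt.min _ hn, fun _ j => ⟨fun hj => ?_, fun hj => ?_⟩⟩
      · exact not_lt.1 (wellFounded_lt.not_lt_min {i | γ ∈ B i} hj)
      · exact hBm hj (wellFounded_lt.min_mem _ hn)
    · exact ⟨hne.some, fun h => absurd h hγ⟩
  choose ρ hρ using hρ
  have hcut : ∀ x : Γ → ℝ, support x ⊆ A → ∀ i,
      {γ | ρ γ ≤ i}.indicator x = (B i).indicator x := fun x hxA i => by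
    funext γ
    by_cases hγ : γ ∈ A
    · simp only [indicator_apply, mem_ofPred_eq, hρ γ hγ i]
    · have : x γ = 0 := by_contra fun h => hγ (hxA h)
      simp [indicator_apply, this]
  refine isSigmaCompact_of_levels ρ ?_ ?_ ?_
  · rintro x ⟨hx, hxA⟩
    by_contra hinf
    obtain ⟨f, hf, hfR⟩ := Set.Infinite.exists_strictMono_nat hinf
    have hmono : Monotone fun n => B (f n) := hBm.comp hf.monotone
    obtain ⟨s, hs, hxs⟩ := hC.exists_mem _ (SupportClosed.iUnion hmono fun n => hBc (f n)) x hx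
    obtain ⟨n, hn⟩ := exists_subset_of_subset_iUnion_monotone hmono hs
    have hsub := hBc (f n) s hn _ hxs
    obtain ⟨γ, hγ, hγf⟩ := hfR (n + 1)
    have hγB : γ ∈ B (f (n + 1)) := (hρ γ (hxA hγ) _).2 hγf.le
    have hγn : γ ∈ B (f n) := hsub (by
      rw [mem_support, indicator_of_mem (mem_iUnion.2 ⟨n + 1, hγB⟩)]
      exact hγ)
    have := (hρ γ (hxA hγ) _).1 hγn
    rw [hγf] at this
    exact absurd this (not_le.2 (hf n.lt_succ_self))
  · rintro x ⟨hx, hxA⟩ i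
    rw [hcut x hxA]
    obtain ⟨s, -, hxs⟩ := hC.exists_mem _ (hBc i) x hx
    exact ⟨hC.subset s hxs, support_indicator_subset.trans (hBA i)⟩
  · intro i
    convert ih _ (hBcard i) (B i) (hBc i) rfl using 1
    ext x
    constructor
    · rintro ⟨⟨hx, hxA⟩, hxi⟩
      exact ⟨hx, fun γ hγ => (hρ γ (hxA hγ) i).2 (hxi hγ)⟩
    · rintro ⟨hx, hxB⟩
      exact ⟨⟨hx, hxB.trans (hBA i)⟩, fun γ hγ => (hρ γ (hBA i (hxB hγ)) i).1 (hxB hγ)⟩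

end Traces

theorem corollary1 {Γ : Type*} (X : Set (Γ → ℝ)) (hX : X ⊆ sigmaReal Γ)
    (hL : IsLindelof X) (hS : IsScattered X) : IsSigmaCompact X := by
  obtain ⟨C, hC⟩ := hL.traceable hS
  simpa using hC.isSigmaCompact_of_supportClosed hX univ fun _ _ _ _ => subset_univ _
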